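/- Let $T$ be an associative (not necessarily commutative) ring with identity. Suppose that $T$ is left Noetherian and integral over its center $C(T)$, i.e. every element of $T$ is a root of a monic polynomial with coefficients in $C(T)$. Then either $T$ has a maximal subring, that is, a proper subring $S\subsetneq T$ with $1_T\in S$ such that there is no subring strictly between $S$ and $T$, or $|T|\le 2^{\aleph_0}$. -/

import Mathlib

/-! Maximal subrings come from Zorn's lemma: if a ring is generated by a finite set `F` over a
proper subring `S`, a subring containing `S` and maximal for not containing `F` is a maximal
subring. They also pull back along surjections.

Assume `T` has none. Noetherian induction on two-sided ideals reduces the bound to a quotient `R`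
all of whose proper quotients have size at most continuum. If `R` is not prime, it is assembled from
two proper quotients. If `R` is prime with a nonzero central nonunit `a`, a Krull intersection
argument makes every element determined by its expansion in base `a`, with digits in `R/aR`.
Otherwise the center is a field; integrality and the absence of nontrivial idempotents make every
element a unit or nilpotent, so `R` is a division ring. A noncentral element would give a maximal
subring, hence `R` is a field, and an uncountable field has a maximal subring. -/

/-! ### Sources of maximal subrings -/

theorem Subring.exists_maximal_not_subset {R : Type*} [Ring R] (S : Subring R) {F : Set R}
    (hF : F.Finite) (hS : ¬ F ⊆ S) :
    ∃ V : Subring R, S ≤ V ∧ ¬ F ⊆ V ∧ ∀ W : Subring R, V < W → F ⊆ W := by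
  obtain ⟨V, hV, hmax⟩ := zorn_le_nonempty₀ {V : Subring R | ¬ F ⊆ V} (by
    intro c hc hchain y hy
    refine ⟨sSup c, ?_, fun z hz => le_sSup hz⟩
    intro hsub
    have hdir : DirectedOn (· ≤ ·) c := hchain.directedOn
    -- Finiteness of `F` is used here: a finite subset of a directed union lies in one member.
    have hex : ∀ s : Set R, s.Finite → s ⊆ F → ∃ W ∈ c, s ⊆ W := by
      intro s hs
      induction s, hs using Set.Finite.induction_on with
      | empty => exact fun _ => ⟨y, hy, Set.empty_subset _⟩
      | insert _ _ ih =>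
        rename_i a s _ _
        intro hsF
        obtain ⟨W, hW, hsW⟩ := ih ((Set.subset_insert _ _).trans hsF)
        obtain ⟨W', hW', ha⟩ := (Subring.mem_sSup_of_directedOn ⟨y, hy⟩ hdir).1
          (hsub (hsF (Set.mem_insert _ _)))
        obtain ⟨U, hU, h1, h2⟩ := hdir W hW W' hW'
        exact ⟨U, hU, Set.insert_subset (h2 ha) (hsW.trans h1)⟩
    obtain ⟨W, hW, hFW⟩ := hex F hF subset_rfl
    exact hc hW hFW) S hS
  refine ⟨V, hV, hmax.prop, fun W hW => ?_⟩
  by_contra h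
  exact hW.not_ge (hmax.le_of_ge h hW.le)

theorem Subring.exists_isCoatom_of_finite_generation {R : Type*} [Ring R] (S : Subring R)
    {F : Set R} (hF : F.Finite) (hS : S ≠ ⊤) (h : ∀ V : Subring R, S ≤ V → F ⊆ V → V = ⊤) :
    ∃ M : Subring R, IsCoatom M := by
  obtain ⟨V, hSV, hV, hmax⟩ := S.exists_maximal_not_subset hF fun hFS => hS (h S le_rfl hFS)
  exact ⟨V, fun hV' => hV (hV' ▸ Set.subset_univ _),
    fun W hW => h W (hSV.trans hW.le) (hmax W hW)⟩

theorem Subring.exists_isCoatom_of_surjective {R S : Type*} [Ring R] [Ring S] (f : R →+* S)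
    (hf : Function.Surjective f) (h : ∃ M : Subring S, IsCoatom M) :
    ∃ M : Subring R, IsCoatom M := by
  obtain ⟨M, hM⟩ := h
  refine ⟨M.comap f, fun htop => hM.1 ?_, fun W hW => ?_⟩
  · rw [eq_top_iff]
    intro s _
    obtain ⟨r, rfl⟩ := hf s
    have : r ∈ M.comap f := htop ▸ Subring.mem_top r
    exact this
  · have hker : ∀ r, f r = 0 → r ∈ W := fun r hr => hW.le (by simp [hr])
    have hmap : W.map f = ⊤ := by
      refine hM.2 _ (lt_of_le_of_ne ?_ ?_)
      · intro s hs
        obtain ⟨r, rfl⟩ := hf s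
        exact ⟨r, hW.le hs, rfl⟩
      · intro he
        refine hW.not_ge fun r hr => ?_
        change f r ∈ M
        rw [he]
        exact ⟨r, hr, rfl⟩
    rw [eq_top_iff]
    intro r _
    obtain ⟨w, hw, hwr⟩ : f r ∈ W.map f := hmap ▸ Subring.mem_top _
    have := W.add_mem hw (hker (r - w) (by rw [map_sub, ← hwr]; simp))
    simpa using this

/-! ### Prime left Noetherian rings: idempotents and nilpotents -/

/-- A prime left Noetherian ring with a nontrivial idempotent has a maximal subring: the ring is
finitely generated over the subring preserving `R e`. -/
theorem Subring.exists_isCoatom_of_isIdempotentElem {R : Type*} [Ring R] [IsNoetherianRing R]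
    (hprime : ∀ a b : R, (∀ t, a * t * b = 0) → a = 0 ∨ b = 0) {e : R} (he : IsIdempotentElem e)
    (h0 : e ≠ 0) (h1 : e ≠ 1) : ∃ M : Subring R, IsCoatom M := by
  set f := 1 - e with hf
  have hee : e * e = e := he
  have hff : f * f = f := he.one_sub
  have hfe : f * e = 0 := by rw [hf, sub_mul, one_mul, hee, sub_self]
  have hef : e + f = 1 := by rw [hf]; abel
  -- In the Peirce decomposition for `e`, `f` this is the block triangular subring: only the corner
  -- `fRe` is missing.
  let S : Subring R :=
    { carrier := {x | f * x * e = 0}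
      mul_mem' := by
        intro x y hx hy
        have hx' : f * x * e = 0 := hx
        have hy' : f * y * e = 0 := hy
        change f * (x * y) * e = 0
        calc f * (x * y) * e = f * x * (e + f) * y * e := by rw [hef]; noncomm_ring
          _ = (f * x * e) * y * e + f * x * (f * y * e) := by noncomm_ring
          _ = 0 := by rw [hx', hy']; simp
      one_mem' := by simpa using hfe
      add_mem' := by
        intro x y hx hy
        have hx' : f * x * e = 0 := hx
        have hy' : f * y * e = 0 := hy
        change f * (x + y) * e = 0
        rw [mul_add, add_mul, hx', hy', add_zero]
      zero_mem' := by simp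
      neg_mem' := by
        intro x hx
        have hx' : f * x * e = 0 := hx
        change f * (-x) * e = 0
        simp [hx'] }
  have hS : ∀ x, x ∈ S ↔ f * x * e = 0 := fun x => Iff.rfl
  let G : Set R := Set.range fun r => f * r * e
  obtain ⟨F, hFG, hF⟩ := (Submodule.fg_span_iff_fg_span_finset_subset G).1
    (IsNoetherian.noetherian (Submodule.span R G))
  refine S.exists_isCoatom_of_finite_generation F.finite_toSet ?_ ?_
  · intro htop
    rcases hprime f e fun t => (hS t).1 (htop ▸ Subring.mem_top t) with h | h
    · exact h1 (by rw [← hef, h, add_zero])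
    · exact h0 h
  · intro V hSV hFV
    -- For a generator `g` in `fRe`, `f r g = (f r f) g` and `f r f` lies in `S`, so finitely many
    -- left ideal generators recover the whole corner.
    have key : ∀ z ∈ Submodule.span R G, ∀ r, f * r * z ∈ V := by
      rw [hF]
      intro z hz
      induction hz using Submodule.span_induction with
      | mem g hg =>
        intro r
        obtain ⟨s, hs⟩ := hFG hg
        have hs : f * s * e = g := hs
        have : f * r * g = (f * r * f) * g := by
          rw [← hs]
          calc f * r * (f * s * e) = f * r * ((f * f) * s * e) := by rw [hff]
            _ = _ := by noncomm_ring
        rw [this]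
        refine V.mul_mem (hSV ((hS _).2 ?_)) (hFV hg)
        calc f * (f * r * f) * e = f * f * r * (f * e) := by noncomm_ring
          _ = 0 := by rw [hfe, mul_zero]
      | zero => intro r; simp
      | add x y _ _ hx hy => intro r; rw [mul_add]; exact V.add_mem (hx r) (hy r)
      | smul s x _ hx =>
        intro r
        have := hx (r * s)
        rwa [smul_eq_mul, ← mul_assoc, mul_assoc f r s]
    rw [eq_top_iff]
    intro x _
    have h2 : f * x * e ∈ V := by
      have := key _ (Submodule.subset_span ⟨x, rfl⟩) 1
      have h3 : f * 1 * (f * x * e) = f * x * e := by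
        calc f * 1 * (f * x * e) = f * f * x * e := by noncomm_ring
          _ = _ := by rw [hff]
      exact h3 ▸ this
    have h3 : x - f * x * e ∈ V := hSV ((hS _).2 (by
      calc f * (x - f * x * e) * e = f * x * e - f * f * x * (e * e) := by noncomm_ring
        _ = 0 := by rw [hff, hee, sub_self]))
    simpa using V.add_mem h3 h2

/-- A prime left Noetherian ring has no nonzero nil two-sided ideals. -/
theorem eq_zero_of_forall_isNilpotent_mul {R : Type*} [Ring R] [IsNoetherianRing R]
    (hprime : ∀ a b : R, (∀ t, a * t * b = 0) → a = 0 ∨ b = 0) (N : Ideal R) [N.IsTwoSided]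
    (hN : ∀ x ∈ N, IsNilpotent x) : N = ⊥ := by
  by_contra hne
  obtain ⟨b, hb, hb0⟩ := Submodule.exists_mem_ne_zero_of_ne_bot hne
  let ann : R → Ideal R := fun a => LinearMap.ker (LinearMap.toSpanSingleton R R a)
  have hann : ∀ a x, x ∈ ann a ↔ x * a = 0 := fun a x => by simp [ann]
  -- Choose `a` with maximal left annihilator. The last nonzero power of `a t` then has the same
  -- annihilator as `a`, and `a t` kills that power, so `a t a = 0`.
  obtain ⟨_, ⟨a, ⟨haN, ha0⟩, rfl⟩, hmax⟩ := set_has_maximal_iff_noetherian.2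
    (inferInstanceAs (IsNoetherian R R)) (ann '' {a | a ∈ N ∧ a ≠ 0}) ⟨_, b, ⟨hb, hb0⟩, rfl⟩
  have key : ∀ t, a * t * a = 0 := by
    intro t
    by_cases hat : a * t = 0
    · rw [hat, zero_mul]
    obtain ⟨n, hn0, hn⟩ : ∃ n, (a * t) ^ (n + 1) ≠ 0 ∧ (a * t) ^ (n + 2) = 0 := by
      have hnil := hN _ (N.mul_mem_right t haN)
      classical
      have h0 : Nat.find hnil ≠ 0 := fun h => by
        have := Nat.find_spec hnil
        rw [h, pow_zero] at this
        exact hat (by rw [← mul_one (a * t), this, mul_zero])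
      have h1 : Nat.find hnil ≠ 1 := fun h => by
        have := Nat.find_spec hnil
        rw [h, pow_one] at this
        exact hat this
      obtain ⟨n, hn⟩ : ∃ n, Nat.find hnil = n + 2 := ⟨Nat.find hnil - 2, by omega⟩
      exact ⟨n, Nat.find_min hnil (by omega), hn ▸ Nat.find_spec hnil⟩
    have hle : ann a ≤ ann ((a * t) ^ (n + 1)) := by
      intro x hx
      rw [hann] at hx ⊢
      rw [pow_succ', ← mul_assoc, ← mul_assoc, hx, zero_mul, zero_mul]
    have hmem : (a * t) ^ (n + 1) ∈ N := by
      rw [pow_succ', mul_assoc]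
      exact N.mul_mem_right _ haN
    have heq : ann ((a * t) ^ (n + 1)) = ann a := by
      by_contra hne'
      exact hmax _ ⟨_, ⟨hmem, hn0⟩, rfl⟩ (lt_of_le_of_ne hle (Ne.symm hne'))
    rw [← hann, ← heq, hann, ← pow_succ']
    exact hn
  rcases hprime a a key with h | h <;> exact ha0 h

/-- A prime left Noetherian ring whose elements are units or nilpotent is a division ring. -/
theorem isUnit_or_eq_zero_of_isUnit_or_isNilpotent {R : Type*} [Ring R] [IsNoetherianRing R]
    (hprime : ∀ a b : R, (∀ t, a * t * b = 0) → a = 0 ∨ b = 0)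
    (h : ∀ a : R, IsUnit a ∨ IsNilpotent a) (a : R) : IsUnit a ∨ a = 0 := by
  rcases subsingleton_or_nontrivial R with hs | hs
  · exact Or.inr (Subsingleton.elim _ _)
  have hunit : ∀ x : R, IsUnit x → ¬ IsNilpotent x := fun x hx hn => hx.not_isNilpotent hn
  have hleft : ∀ s x : R, IsNilpotent x → IsNilpotent (s * x) := by
    intro s x hx
    refine (h (s * x)).resolve_left fun hu => ?_
    obtain ⟨u, hu⟩ := hu
    have h1 : (↑u⁻¹ * s) * x = 1 := by rw [mul_assoc, ← hu, Units.inv_mul]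
    have : ∀ n, x ^ n = 0 → (1 : R) = 0 := by
      intro n
      induction n with
      | zero => simp
      | succ n ih =>
        intro h0
        refine ih ?_
        rw [← one_mul (x ^ n), ← h1, mul_assoc, ← pow_succ', h0, mul_zero]
    obtain ⟨n, hn⟩ := hx
    exact one_ne_zero (this n hn)
  have hright : ∀ s x : R, IsNilpotent x → IsNilpotent (x * s) := by
    intro s x hx
    obtain ⟨n, hn⟩ := hleft s x hx
    refine ⟨n + 1, ?_⟩
    have : (x * s) ^ (n + 1) = x * (s * x) ^ n * s := by
      rw [pow_succ, ← mul_assoc, mul_pow_mul]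
    rw [this, hn, mul_zero, zero_mul]
  let N : Ideal R :=
    { carrier := {x | IsNilpotent x}
      zero_mem' := IsNilpotent.zero
      smul_mem' := fun s x hx => hleft s x hx
      add_mem' := by
        intro x y hx hy
        refine (h (x + y)).resolve_left fun ⟨u, hu⟩ => ?_
        have h1 : ↑u⁻¹ * x = 1 - ↑u⁻¹ * y := by
          rw [eq_sub_iff_add_eq, ← mul_add, ← hu, Units.inv_mul]
        exact hunit _ (h1 ▸ (hleft _ y hy).isUnit_one_sub) (hleft _ x hx) }
  have : N.IsTwoSided := ⟨fun s hx => hright s _ hx⟩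
  refine (h a).imp_right fun ha => ?_
  have hN := eq_zero_of_forall_isNilpotent_mul hprime N fun x hx => hx
  have : a ∈ N := ha
  simpa [hN] using this

/-! ### Expansions in base a central nonunit -/

/-- Krull intersection for a central nonunit in a prime left Noetherian ring integral over its
center. -/
theorem eq_zero_of_forall_pow_dvd {R : Type*} [Ring R] [IsNoetherianRing R]
    [Algebra.IsIntegral (Subring.center R) R]
    (hprime : ∀ a b : R, (∀ t, a * t * b = 0) → a = 0 ∨ b = 0) {a : R}
    (ha : a ∈ Subring.center R) (ha0 : a ≠ 0) (hu : ¬ IsUnit a) {x : R}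
    (hx : ∀ n, ∃ t, x = a ^ n * t) : x = 0 := by
  have hcomm : ∀ r, r * a = a * r := Subring.mem_center_iff.1 ha
  have hcent : ∀ z ∈ Subring.center R, z ≠ 0 → ∀ y, z * y = 0 → y = 0 := by
    intro z hz hz0 y hy
    refine (hprime z y fun t => ?_).resolve_left hz0
    rw [← Subring.mem_center_iff.1 hz t, mul_assoc, hy, mul_zero]
  choose t ht using hx
  have hstep : ∀ n, t n = a * t (n + 1) := by
    intro n
    have h1 : ∀ n y, a ^ n * y = 0 → y = 0 := by
      intro n
      induction n with
      | zero => intro y hy; simpa using hy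
      | succ n ih =>
        intro y hy
        rw [pow_succ, mul_assoc] at hy
        exact hcent a ha ha0 _ (ih _ hy)
    refine sub_eq_zero.1 (h1 n _ ?_)
    rw [mul_sub, ← ht n, ← mul_assoc, ← pow_succ, ← ht (n + 1), sub_self]
  -- Since `t n = a * t (n + 1)`, these left ideals ascend; once they stabilize, `y = t (n + 1)`
  -- satisfies `s a y = y` for some `s`.
  have hmono : Monotone fun n => Submodule.span R {t n} := by
    refine monotone_nat_of_le_succ fun n => ?_
    rw [Submodule.span_singleton_le_iff_mem, Submodule.mem_span_singleton]
    exact ⟨a, (hstep n).symm⟩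
  obtain ⟨n, hn⟩ := monotone_stabilizes_iff_noetherian.2 (inferInstanceAs (IsNoetherian R R))
    ⟨_, hmono⟩
  have hmem : t (n + 1) ∈ Submodule.span R {t n} := by
    have h := hn (n + 1) n.le_succ
    change Submodule.span R {t n} = Submodule.span R {t (n + 1)} at h
    rw [h]
    exact Submodule.mem_span_singleton_self _
  obtain ⟨s, hs⟩ := Submodule.mem_span_singleton.1 hmem
  set y := t (n + 1) with hy
  have hsy : s * a * y = y := by rw [mul_assoc, hy, ← hstep, ← smul_eq_mul, hs]
  have hpow : ∀ k, a ^ k * s ^ k * y = y := by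
    intro k
    have hc : Commute a s := (hcomm s).symm
    rw [← hc.mul_pow, hc.eq]
    induction k with
    | zero => simp
    | succ k ih => rw [pow_succ, mul_assoc, hsy, ih]
  obtain ⟨p, hp, hps⟩ := Algebra.IsIntegral.isIntegral (R := Subring.center R) s
  have hps' : ∑ i ∈ Finset.range (p.natDegree + 1), (p.coeff i : R) * s ^ i = 0 := by
    rw [Polynomial.eval₂_eq_sum_range] at hps
    exact hps
  set m := p.natDegree with hm
  -- Multiplying the integral equation of `s` by `a ^ m` and using `a ^ i s ^ i y = y` gives `d y =
  -- 0`. The leading term makes `d = 1 + a z`, so `d = 0` would make `a` a unit.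
  set d : R := ∑ i ∈ Finset.range (m + 1), (p.coeff i : R) * a ^ (m - i) with hd
  have hdy : d * y = 0 := by
    calc d * y = a ^ m * (∑ i ∈ Finset.range (m + 1), (p.coeff i : R) * s ^ i) * y := by
          rw [hd, Finset.sum_mul, Finset.mul_sum, Finset.sum_mul]
          refine Finset.sum_congr rfl fun i hi => ?_
          have hi : i ≤ m := Nat.lt_succ_iff.1 (Finset.mem_range.1 hi)
          have hci := fun r => Subring.mem_center_iff.1 (p.coeff i).2 r
          conv_lhs => rw [← hpow i]
          rw [← mul_assoc, ← mul_assoc, mul_assoc _ (a ^ (m - i)), ← pow_add,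
            Nat.sub_add_cancel hi, ← mul_assoc (a ^ m), hci]
      _ = 0 := by rw [hps', mul_zero, zero_mul]
  have hdc : d ∈ Subring.center R :=
    sum_mem fun i _ => mul_mem (p.coeff i).2 (pow_mem ha _)
  have hd0 : d ≠ 0 := by
    intro h0
    refine hu ?_
    have h2 : d = 1 + a * ∑ i ∈ Finset.range m, (p.coeff i : R) * a ^ (m - 1 - i) := by
      rw [hd, Finset.sum_range_succ, add_comm, Finset.mul_sum]
      congr 1
      · have : p.coeff m = 1 := hp
        simp [this]
      · refine Finset.sum_congr rfl fun i hi => ?_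
        have hi := Finset.mem_range.1 hi
        rw [← mul_assoc, ← hcomm, mul_assoc, ← pow_succ', show m - 1 - i + 1 = m - i by omega]
    rw [h0] at h2
    set z := ∑ i ∈ Finset.range m, (p.coeff i : R) * a ^ (m - 1 - i)
    have h3 : a * (-z) = 1 := by rw [mul_neg, eq_comm, ← sub_eq_zero, sub_neg_eq_add, ← h2]
    exact ⟨⟨a, -z, h3, by rw [hcomm, h3]⟩, rfl⟩
  have hy0 := hcent d hdc hd0 y hdy
  rw [ht (n + 1), ← hy, hy0, mul_zero]

/-- Expansion in base `a`. -/
theorem Cardinal.mk_le_continuum_of_adic_separated {R : Type*} [Ring R] (a : R) (I : Ideal R)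
    (hI : ∀ x ∈ I, ∃ t, x = a * t) (hsep : ∀ x : R, (∀ n, ∃ t, x = a ^ n * t) → x = 0)
    (hcard : Cardinal.mk (R ⧸ I) ≤ Cardinal.continuum) : Cardinal.mk R ≤ Cardinal.continuum := by
  have hex : ∀ x : R, ∃ t, x - (Submodule.Quotient.mk x : R ⧸ I).out = a * t := fun x => by
    refine hI _ ((Submodule.Quotient.eq I).1 ?_)
    exact (Quotient.out_eq' _).symm
  -- `next` is the digit shift: `x` is its lowest digit plus `a * next x`.
  choose next hnext using hex
  let digits : R → ℕ → R ⧸ I := fun x n => Submodule.Quotient.mk (next^[n] x)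
  have hinj : Function.Injective digits := by
    intro x y hxy
    refine sub_eq_zero.1 (hsep _ fun n => ⟨next^[n] x - next^[n] y, ?_⟩)
    induction n with
    | zero => simp
    | succ n ih =>
      have h1 := hnext (next^[n] x)
      have h2 := hnext (next^[n] y)
      have h3 : (Submodule.Quotient.mk (next^[n] x) : R ⧸ I) =
        Submodule.Quotient.mk (next^[n] y) := congrFun hxy n
      rw [h3] at h1
      rw [ih, Function.iterate_succ_apply', Function.iterate_succ_apply', pow_succ, mul_assoc,
        mul_sub a, ← h1, ← h2]
      congr 1
      abel
  calc Cardinal.mk R ≤ Cardinal.mk (ℕ → R ⧸ I) := Cardinal.mk_le_of_injective hinj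
    _ = Cardinal.mk (R ⧸ I) ^ Cardinal.aleph0 := by simp
    _ ≤ Cardinal.continuum ^ Cardinal.aleph0 := Cardinal.power_le_power_right hcard
    _ = Cardinal.continuum := Cardinal.continuum_power_aleph0

/-! ### Integral elements when the center is a field -/

-- Factor the integral equation as `X ^ k * g` with `g(0) ≠ 0`. The constant term is then an
-- invertible central element, and `t ^ k * g(t) = 0` can be solved for `t ^ k`.
open Polynomial in
theorem exists_pow_eq_pow_succ_mul {R : Type*} [Ring R]
    (hfield : ∀ a ∈ Subring.center R, a ≠ 0 → IsUnit a) {t : R}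
    (ht : IsIntegral (Subring.center R) t) :
    ∃ (k : ℕ) (q : R), Commute t q ∧ t ^ k = t ^ (k + 1) * q := by
  rcases subsingleton_or_nontrivial R with h | h
  · exact ⟨0, 0, Commute.zero_right _, Subsingleton.elim _ _⟩
  obtain ⟨p, hp, hpt⟩ := ht
  obtain ⟨g, hg, hgX⟩ := p.exists_eq_pow_rootMultiplicity_mul_and_not_dvd hp.ne_zero 0
  set k := p.rootMultiplicity 0
  rw [C_0, sub_zero] at hg hgX
  rw [X_dvd_iff] at hgX
  obtain ⟨u, hu⟩ := hfield (g.coeff 0) (g.coeff 0).2 (by simpa using hgX)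
  have hg2 : aeval t g = t * aeval t g.divX + u := by
    conv_lhs => rw [← g.divX_mul_X_add, mul_comm]
    rw [map_add, map_mul, aeval_X, aeval_C, hu]
    rfl
  have h0 : t ^ k * aeval t g = 0 := by
    have : aeval t p = 0 := hpt
    rwa [hg, map_mul, map_pow, aeval_X] at this
  have hut : ∀ r, r * (u : R) = u * r := by
    rw [hu]; exact Subring.mem_center_iff.1 (g.coeff 0).2
  have hc1 : Commute t (aeval t g.divX) := by
    have : Commute (aeval t (X : (Subring.center R)[X])) (aeval t g.divX) :=
      (Commute.all _ _).map (aeval t)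
    rwa [aeval_X] at this
  have hc2 : Commute t (↑u⁻¹ : R) := Commute.units_inv_right (hut t)
  refine ⟨k, -(aeval t g.divX * ↑u⁻¹), (hc1.mul_right hc2).neg_right, ?_⟩
  rw [hg2, mul_add] at h0
  have h1 : t ^ k = -(t ^ k * (t * aeval t g.divX)) * ↑u⁻¹ := by
    rw [← eq_neg_of_add_eq_zero_right h0, mul_assoc, Units.mul_inv, mul_one]
  rw [h1]
  conv_lhs => rw [← h1]
  rw [pow_succ]
  conv_lhs => rw [h1]
  noncomm_ring

/-- A Fitting-type argument: `(t q) ^ k` is idempotent and fixes `t ^ k`. If it is `0` then `t ^ k =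
0`; if it is `1` then `t` is invertible. -/
theorem isUnit_or_isNilpotent_of_isIntegral {R : Type*} [Ring R]
    (hfield : ∀ a ∈ Subring.center R, a ≠ 0 → IsUnit a)
    (hidem : ∀ e : R, IsIdempotentElem e → e = 0 ∨ e = 1) {t : R}
    (ht : IsIntegral (Subring.center R) t) : IsUnit t ∨ IsNilpotent t := by
  obtain ⟨k, q, hc, hk⟩ := exists_pow_eq_pow_succ_mul hfield ht
  have hit : ∀ j, t ^ k = t ^ k * (t * q) ^ j := by
    intro j
    induction j with
    | zero => simp
    | succ j ih => rw [pow_succ', ← mul_assoc, ← mul_assoc, ← pow_succ, ← hk, ← ih]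
  have hpow : (t * q) ^ k = q ^ k * t ^ k := by rw [hc.eq, hc.symm.mul_pow]
  have he : IsIdempotentElem ((t * q) ^ k) := by
    change (t * q) ^ k * (t * q) ^ k = (t * q) ^ k
    conv_lhs => rw [hpow, mul_assoc, ← hpow, ← hit]
    exact hpow.symm
  rcases hidem _ he with h | h
  · exact Or.inr ⟨k, by rw [hit k, h, mul_zero]⟩
  · left
    rcases Nat.eq_zero_or_pos k with rfl | hk0
    · rw [pow_zero, zero_add, pow_one] at hk
      exact ⟨⟨t, q, hk.symm, by rw [← hc.eq, ← hk]⟩, rfl⟩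
    · have hu : IsUnit (t * q) := (isUnit_pow_iff hk0.ne').1 (h ▸ isUnit_one)
      exact (hc.isUnit_mul_iff.1 hu).1

/-! ### Uncountable fields -/

open Polynomial in
/-- If `K` is algebraic over `k[x]` with `x` transcendental over `k`, a subring containing `k[x]`
that is maximal without `x⁻¹` is a maximal subring of `K`. -/
theorem Subring.exists_isCoatom_of_transcendental {k K : Type*} [Field k] [Field K] [Algebra k K]
    {x : K} (hx : Transcendental k x) [Algebra.IsAlgebraic (Algebra.adjoin k {x}) K] :
    ∃ M : Subring K, IsCoatom M := by
  set S : Subring K := (Algebra.adjoin k {x}).toSubring with hS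
  have hmemS : ∀ p : k[X], aeval x p ∈ S := fun p => by
    have := aeval_mem_adjoin_singleton k x (p := p)
    exact this
  have hx0 : x ≠ 0 := fun h => hx (h ▸ isAlgebraic_zero)
  obtain ⟨V, hSV, hV, hmax⟩ := S.exists_maximal_not_subset (Set.finite_singleton x⁻¹) (by
    rw [Set.singleton_subset_iff]
    intro hmem
    have hmem : x⁻¹ ∈ Algebra.adjoin k {x} := hmem
    rw [Algebra.adjoin_singleton_eq_range_aeval] at hmem
    obtain ⟨p, hp⟩ := hmem
    have hp : aeval x p = x⁻¹ := hp
    refine hx ⟨X * p - 1, fun h => ?_, ?_⟩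
    · have := congrArg (fun q => coeff q 0) h
      simp at this
    · simp [hp, hx0])
  rw [Set.singleton_subset_iff] at hV
  have hVx : x ∈ V := hSV (by simpa using hmemS X)
  have hmax' : ∀ W : Subring K, V ≤ W → x⁻¹ ∉ W → W = V := by
    intro W hW hxW
    by_contra hne
    exact hxW (hmax W (lt_of_le_of_ne hW (Ne.symm hne)) (Set.mem_singleton _))
  -- `V` is integrally closed by maximality: an integral equation for `x⁻¹`, multiplied by `x ^ (n -
  -- 1)`, would put `x⁻¹` in `V`.
  have hint : ∀ y : K, IsIntegral V y → y ∈ V := by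
    intro y hy
    have hle : V ≤ (integralClosure V K).toSubring := fun v hv =>
      isIntegral_algebraMap (R := V) (x := ⟨v, hv⟩)
    have := hmax' _ hle (fun h => hV ?_)
    · rw [← this]; exact hy
    · obtain ⟨p, hp, hpx⟩ : IsIntegral V x⁻¹ := h
      set n := p.natDegree
      have hsum : ∑ i ∈ Finset.range (n + 1), (p.coeff i : K) * x⁻¹ ^ i = 0 := by
        rw [eval₂_eq_sum_range] at hpx
        exact hpx
      rw [Finset.sum_range_succ] at hsum
      have hlead : p.coeff n = 1 := hp
      rcases Nat.eq_zero_or_pos n with h0 | h0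
      · rw [h0] at hsum hlead
        simp [hlead] at hsum
      have hxinv : x⁻¹ = -∑ i ∈ Finset.range n, (p.coeff i : K) * x ^ (n - 1 - i) := by
        have h1 : x⁻¹ ^ n = -∑ i ∈ Finset.range n, (p.coeff i : K) * x⁻¹ ^ i := by
          rw [hlead] at hsum
          rw [eq_neg_iff_add_eq_zero, add_comm]
          simpa using hsum
        have h2 : x⁻¹ = x ^ (n - 1) * x⁻¹ ^ n := by
          conv_rhs => rw [show n = n - 1 + 1 by omega]
          rw [pow_succ, ← mul_assoc, Nat.add_sub_cancel, ← mul_pow, mul_inv_cancel₀ hx0, one_pow,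
            one_mul]
        rw [h2, h1, mul_neg, Finset.mul_sum]
        congr 1
        refine Finset.sum_congr rfl fun i hi => ?_
        have hi := Finset.mem_range.1 hi
        conv_lhs => rw [show n - 1 = n - 1 - i + i by omega]
        rw [pow_add, mul_comm, mul_assoc, mul_comm (x⁻¹ ^ i), mul_assoc, ← mul_pow,
          mul_inv_cancel₀ hx0, one_pow, mul_one]
      rw [hxinv]
      exact neg_mem (sum_mem fun i _ => mul_mem (p.coeff i).2 (pow_mem hVx _))
  -- Otherwise `V[1/g]` is strictly larger, so `g ^ n x⁻¹` lies in `V` for some `n`; the nonzero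
  -- constant term of `p ^ n` then isolates `x⁻¹`.
  have hunit : ∀ p : k[X], p.coeff 0 ≠ 0 → (aeval x p)⁻¹ ∈ V := by
    intro p hp
    have hp0 : aeval x p ≠ 0 := fun h => hx ⟨p, fun h' => hp (by simp [h']), h⟩
    set g := aeval x p with hg
    by_contra hgV
    have hgV' : g ∈ V := hSV (hmemS p)
    let W : Subring K :=
      { carrier := {y | ∃ n : ℕ, g ^ n * y ∈ V}
        mul_mem' := by
          rintro y z ⟨m, hm⟩ ⟨n, hn⟩
          refine ⟨m + n, ?_⟩
          rw [pow_add, mul_mul_mul_comm]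
          exact mul_mem hm hn
        one_mem' := ⟨0, by simp⟩
        add_mem' := by
          rintro y z ⟨m, hm⟩ ⟨n, hn⟩
          refine ⟨m + n, ?_⟩
          have : g ^ (m + n) * (y + z) = g ^ n * (g ^ m * y) + g ^ m * (g ^ n * z) := by ring
          rw [this]
          exact add_mem (mul_mem (pow_mem hgV' _) hm) (mul_mem (pow_mem hgV' _) hn)
        zero_mem' := ⟨0, by simp⟩
        neg_mem' := by
          rintro y ⟨m, hm⟩
          exact ⟨m, by rw [mul_neg]; exact neg_mem hm⟩ }
    have hVW : V ≤ W := fun v hv => ⟨0, by simpa using hv⟩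
    have hxW : x⁻¹ ∈ W := by
      by_contra h
      refine hgV ?_
      rw [← hmax' W hVW h]
      exact ⟨1, by rw [pow_one, mul_inv_cancel₀ hp0]; exact one_mem V⟩
    obtain ⟨n, hn⟩ := hxW
    have hc : (p ^ n).coeff 0 ≠ 0 := by
      rw [coeff_zero_eq_eval_zero, eval_pow, ← coeff_zero_eq_eval_zero]
      exact pow_ne_zero _ hp
    have hdec : g ^ n * x⁻¹ = aeval x (p ^ n).divX + algebraMap k K ((p ^ n).coeff 0) * x⁻¹ := by
      rw [hg, ← map_pow]
      conv_lhs => rw [← (p ^ n).divX_mul_X_add]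
      rw [map_add, map_mul, aeval_X, aeval_C, add_mul, mul_assoc, mul_inv_cancel₀ hx0, mul_one]
    have h1 : algebraMap k K ((p ^ n).coeff 0) * x⁻¹ ∈ V := by
      have := sub_mem hn (hSV (hmemS (p ^ n).divX))
      rwa [hdec, add_sub_cancel_left] at this
    have h2 : algebraMap k K ((p ^ n).coeff 0)⁻¹ ∈ V := by
      have := hSV (hmemS (C ((p ^ n).coeff 0)⁻¹))
      rwa [aeval_C] at this
    have h3 := mul_mem h2 h1
    rw [← mul_assoc, ← map_mul, inv_mul_cancel₀ hc, map_one, one_mul] at h3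
    exact hV h3
  -- This says `K = V[x⁻¹]`: some nonzero `b` in `k[x]` makes `b y` integral, and `b` is a power of
  -- `x` times an element inverted in `V`.
  have hloc : ∀ y : K, ∃ m : ℕ, x ^ m * y ∈ V := by
    intro y
    obtain ⟨b, hb0, hb⟩ := (Algebra.IsAlgebraic.isAlgebraic (R := Algebra.adjoin k {x})
      y).exists_integral_multiple
    obtain ⟨p, hp⟩ := (Algebra.adjoin_singleton_eq_range_aeval k x).le b.2
    have hp : aeval x p = (b : K) := hp
    have hp0 : p ≠ 0 := fun h => hb0 (Subtype.ext (by rw [← hp, h, map_zero]; rfl))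
    obtain ⟨q, hq, hqX⟩ := p.exists_eq_pow_rootMultiplicity_mul_and_not_dvd hp0 0
    set m := p.rootMultiplicity 0
    rw [C_0, sub_zero] at hq hqX
    rw [X_dvd_iff] at hqX
    have hq0 : aeval x q ≠ 0 := fun h => hx ⟨q, fun h' => hqX (by simp [h']), h⟩
    have hby : (b : K) * y ∈ V := by
      refine hint _ ?_
      obtain ⟨P, hP, hPy⟩ := hb
      refine ⟨P.map (Subring.inclusion (S := S) hSV), hP.map _, ?_⟩
      rw [eval₂_map]
      exact hPy
    refine ⟨m, ?_⟩
    have : x ^ m * y = (aeval x q)⁻¹ * (b * y) := by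
      rw [← hp, hq, map_mul, map_pow, aeval_X]
      field_simp
    rw [this]
    exact mul_mem (hunit q hqX) hby
  refine ⟨V, fun h => hV (h ▸ Subring.mem_top _), fun W hW => ?_⟩
  have hxW : x⁻¹ ∈ W := hmax W hW (Set.mem_singleton _)
  rw [eq_top_iff]
  intro y _
  obtain ⟨m, hm⟩ := hloc y
  have := mul_mem (pow_mem hxW m) (hW.le hm)
  rwa [← mul_assoc, ← mul_pow, inv_mul_cancel₀ hx0, one_pow, one_mul] at this

theorem Algebra.IsAlgebraic.of_subalgebra_subset {F L K : Type*} [CommRing F] [CommRing L]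
    [CommRing K] [Algebra F K] [Algebra L K] (A : Subalgebra F K) (B : Subalgebra L K)
    (h : ∀ z ∈ A, z ∈ B) [Algebra.IsAlgebraic A K] : Algebra.IsAlgebraic B K := by
  refine ⟨fun y => ?_⟩
  obtain ⟨p, hp, hpy⟩ := Algebra.IsAlgebraic.isAlgebraic (R := A) y
  let φ : A →+* B := Subring.inclusion (S := A.toSubring) (T := B.toSubring) h
  have hφ : Function.Injective φ := Set.inclusion_injective h
  refine ⟨p.map φ, (Polynomial.map_ne_zero_iff hφ).2 hp, ?_⟩
  rw [Polynomial.aeval_def, Polynomial.eval₂_map]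
  exact hpy

-- The prime field is countable, so a transcendence basis over it is nonempty. Single out one member
-- as `x` and adjoin the others to form the base field.
open IntermediateField.algebraAdjoinAdjoin in
theorem Subring.exists_isCoatom_of_aleph0_lt {K : Type*} [Field K]
    (hK : Cardinal.aleph0 < Cardinal.mk K) : ∃ M : Subring K, IsCoatom M := by
  let F : Subfield K := Subfield.closure ∅
  have hF : Cardinal.mk F ≤ Cardinal.aleph0 :=
    (Subfield.cardinalMk_closure_le_max ∅).trans (by simp)
  have hnalg : ¬ Algebra.IsAlgebraic F K := fun h =>
    hK.not_ge ((Algebra.IsAlgebraic.cardinalMk_le_max F K).trans (max_le hF le_rfl))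
  obtain ⟨s, hs⟩ := exists_isTranscendenceBasis F K
  obtain ⟨i⟩ : Nonempty s := by
    by_contra h
    exact hnalg (hs.isEmpty_iff_isAlgebraic.1 (not_nonempty_iff.1 h))
  let B : Set K := Subtype.val '' ({i}ᶜ : Set s)
  let L := IntermediateField.adjoin F B
  have htr : Transcendental L (i : K) := by
    have h1 : Transcendental (Algebra.adjoin F B) (i : K) :=
      hs.1.transcendental_adjoin (s := {i}ᶜ) (i := i) (by simp)
    intro h2
    exact h1 ((IsFractionRing.isAlgebraic_iff (Algebra.adjoin F B) L K).2 h2)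
  have halg : Algebra.IsAlgebraic (Algebra.adjoin L {(i : K)}) K := by
    have h1 := hs.isAlgebraic
    have hle : Algebra.adjoin F (Set.range ((↑) : s → K)) ≤
        (Algebra.adjoin L {(i : K)}).restrictScalars F := by
      refine Algebra.adjoin_le ?_
      rintro _ ⟨j, rfl⟩
      change (j : K) ∈ Algebra.adjoin L {(i : K)}
      by_cases hj : j = i
      · rw [hj]
        exact Algebra.self_mem_adjoin_singleton L (i : K)
      · have hjB : (j : K) ∈ L := IntermediateField.subset_adjoin F B ⟨j, hj, rfl⟩
        exact (Algebra.adjoin L {(i : K)}).algebraMap_mem ⟨j, hjB⟩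
    exact Algebra.IsAlgebraic.of_subalgebra_subset _ _ hle
  exact Subring.exists_isCoatom_of_transcendental htr

/-! ### Noncommutative division rings -/

/-- A division ring is finite-dimensional over the centralizer of an element integral over the
center. -/
theorem not_linearIndependent_of_isIntegral {D : Type*} [DivisionRing D] {a : D}
    (S : Subfield D) (hS : ∀ z, z ∈ S ↔ z * a = a * z) {p : Polynomial (Subring.center D)}
    (hp : p.Monic) (hpa : Polynomial.aeval a p = 0) {n : ℕ} (hn : p.natDegree = n)
    (x : Fin (n + 1) → D) : ¬ LinearIndependent S x := by
  intro hli
  let P : (Fin (n + 1) → D) → Prop := fun y => ∀ k, ∑ j, y j * (a ^ k * x j) = 0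
  let Φ : (Fin (n + 1) → D) →ₗ[D] (Fin n → D) :=
    { toFun := fun y i => ∑ j, y j * (a ^ (i : ℕ) * x j)
      map_add' := fun y z => by
        ext i
        simp [add_mul, Finset.sum_add_distrib]
      map_smul' := fun r y => by
        ext i
        simp [Finset.mul_sum, mul_assoc] }
  -- There are `n` equations in `n + 1` unknowns for `k < n`; the integral equation of `a`
  -- propagates them to all `k`.
  have hex : ∃ y, P y ∧ y ≠ 0 := by
    obtain ⟨y, hy, hy0⟩ := Submodule.exists_mem_ne_zero_of_ne_bot
      (Φ.ker_ne_bot_of_finrank_lt (by simp))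
    refine ⟨y, fun k => ?_, hy0⟩
    induction k using Nat.strong_induction_on with
    | _ k ih =>
    by_cases hk : k < n
    · exact congrFun (LinearMap.mem_ker.1 hy) ⟨k, hk⟩
    · have hak : a ^ k = -∑ i ∈ Finset.range n, (p.coeff i : D) * a ^ (k - n + i) := by
        have hsum : ∑ i ∈ Finset.range (n + 1), (p.coeff i : D) * a ^ i = 0 := by
          rw [Polynomial.aeval_def, Polynomial.eval₂_eq_sum_range, hn] at hpa
          exact hpa
        have hlead : p.coeff n = 1 := hn ▸ hp
        rw [Finset.sum_range_succ, hlead] at hsum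
        have h1 : a ^ n = -∑ i ∈ Finset.range n, (p.coeff i : D) * a ^ i := by
          rw [eq_neg_iff_add_eq_zero, add_comm]
          simpa using hsum
        conv_lhs => rw [show k = k - n + n by omega, pow_add, h1, mul_neg, Finset.mul_sum]
        congr 1
        refine Finset.sum_congr rfl fun i _ => ?_
        rw [pow_add, ← mul_assoc, ← mul_assoc, Subring.mem_center_iff.1 (p.coeff i).2]
      have : ∑ j, y j * (a ^ k * x j) =
          -∑ i ∈ Finset.range n, (p.coeff i : D) * ∑ j, y j * (a ^ (k - n + i) * x j) := by
        simp_rw [hak, neg_mul, mul_neg, Finset.sum_mul, Finset.mul_sum]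
        rw [Finset.sum_neg_distrib, Finset.sum_comm]
        congr 1
        refine Finset.sum_congr rfl fun i _ => Finset.sum_congr rfl fun j _ => ?_
        rw [← mul_assoc, ← mul_assoc, Subring.mem_center_iff.1 (p.coeff i).2]
        noncomm_ring
      rw [this, neg_eq_zero]
      refine Finset.sum_eq_zero fun i hi => ?_
      have := Finset.mem_range.1 hi
      rw [ih _ (by omega), mul_zero]
  classical
  -- Artin's shortest relation argument: normalize one coefficient to `1`; commuting with `a` gives
  -- a shorter relation, so all coefficients centralize `a`.
  obtain ⟨y, ⟨hy, hy0⟩, hmin⟩ := exists_minimalFor_of_wellFoundedLT (fun y => P y ∧ y ≠ 0)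
    (fun y => (Finset.univ.filter fun j => y j ≠ 0).card) hex
  obtain ⟨l, hl⟩ := Function.ne_iff.1 hy0
  have hl : y l ≠ 0 := hl
  let w : Fin (n + 1) → D := fun j => (y l)⁻¹ * y j
  have hw : P w := fun k => by
    have := congrArg ((y l)⁻¹ * ·) (hy k)
    simpa [w, Finset.mul_sum, mul_assoc] using this
  have hwl : w l = 1 := inv_mul_cancel₀ hl
  have hwS : ∀ j, w j ∈ S := by
    by_contra hnot
    push Not at hnot
    obtain ⟨j, hj⟩ := hnot
    let z : Fin (n + 1) → D := fun j => w j * a - a * w j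
    have hz : P z := fun k => by
      have h1 := hw (k + 1)
      have h2 := congrArg (a * ·) (hw k)
      simp only [Finset.mul_sum, mul_zero] at h2
      simp only [z, sub_mul, Finset.sum_sub_distrib]
      rw [← h1] at h2
      rw [sub_eq_zero]
      refine Eq.trans ?_ (h2.symm.trans ?_)
      · simp only [pow_succ', mul_assoc]
      · simp only [mul_assoc]
    have hz0 : z ≠ 0 := fun h => hj ((hS _).2 (sub_eq_zero.1 (congrFun h j)))
    have hlt : (Finset.univ.filter fun j => z j ≠ 0).card <
        (Finset.univ.filter fun j => y j ≠ 0).card := by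
      refine Finset.card_lt_card ⟨fun j hj => ?_, fun hsub => ?_⟩
      · simp only [Finset.mem_filter, Finset.mem_univ, true_and] at hj ⊢
        intro h
        exact hj (by simp [z, w, h])
      · have := hsub (show l ∈ _ by simpa using hl)
        simp [z, hwl] at this
    exact hlt.not_ge (hmin ⟨hz, hz0⟩ hlt.le)
  have := Fintype.linearIndependent_iff.1 hli (fun j => ⟨w j, hwS j⟩)
    (by simpa [Subfield.smul_def] using hw 0) l
  have h1 : w l = 0 := congrArg Subtype.val this
  exact one_ne_zero (hwl ▸ h1)

/-- A finite basis over the centralizer of `a`, a proper subring, generates `D` over it. -/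
theorem Subring.exists_isCoatom_of_not_mem_center {D : Type*} [DivisionRing D] {a : D}
    (ha : a ∉ Subring.center D) (hint : IsIntegral (Subring.center D) a) :
    ∃ M : Subring D, IsCoatom M := by
  let S : Subfield D := (Subring.centralizer {a}).toSubfield (by
    intro z hz
    rw [Subring.mem_centralizer_iff] at hz ⊢
    intro b hb
    exact Commute.inv_right₀ (hz b hb))
  have hS : ∀ z, z ∈ S ↔ z * a = a * z := fun z => by
    change z ∈ Subring.centralizer {a} ↔ _
    simp [Subring.mem_centralizer_iff, eq_comm]
  obtain ⟨p, hp, hpa⟩ := hint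
  let b := Module.Basis.ofVectorSpace S D
  have hfin : Finite (Module.Basis.ofVectorSpaceIndex S D) := by
    by_contra h
    have := not_finite_iff_infinite.1 h
    let f : Fin (p.natDegree + 1) ↪ Module.Basis.ofVectorSpaceIndex S D :=
      Fin.valEmbedding.trans (Infinite.natEmbedding _)
    exact not_linearIndependent_of_isIntegral S hS hp hpa rfl _
      (b.linearIndependent.comp f f.injective)
  refine S.toSubring.exists_isCoatom_of_finite_generation (Set.finite_range b) ?_ ?_
  · intro htop
    refine ha (Subring.mem_center_iff.2 fun z => (hS z).1 ?_)
    have : z ∈ S.toSubring := htop ▸ Subring.mem_top z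
    exact this
  · intro V hSV hbV
    have := Fintype.ofFinite (Module.Basis.ofVectorSpaceIndex S D)
    rw [eq_top_iff]
    intro z _
    rw [← b.sum_repr z]
    exact sum_mem fun i _ => mul_mem (hSV (b.repr z i).2) (hbV ⟨i, rfl⟩)

/-! ### Cardinality bounds and Noetherian induction -/

/-- A prime left Noetherian ring integral over its center, without maximal subrings and all of
whose proper quotients have at most continuum cardinality, has at most continuum cardinality. -/
theorem Cardinal.mk_le_continuum_of_prime {R : Type*} [Ring R] [IsNoetherianRing R]
    [Algebra.IsIntegral (Subring.center R) R]
    (hprime : ∀ a b : R, (∀ t, a * t * b = 0) → a = 0 ∨ b = 0)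
    (hmax : ¬ ∃ M : Subring R, IsCoatom M)
    (hquot : ∀ I : Ideal R, I.IsTwoSided → I ≠ ⊥ → Cardinal.mk (R ⧸ I) ≤ Cardinal.continuum) :
    Cardinal.mk R ≤ Cardinal.continuum := by
  rcases subsingleton_or_nontrivial R with hs | hs
  · exact (Cardinal.le_one_iff_subsingleton.2 hs).trans
      (Cardinal.one_le_aleph0.trans Cardinal.aleph0_le_continuum)
  by_cases hfield : ∀ a ∈ Subring.center R, a ≠ 0 → IsUnit a
  · have hidem : ∀ e : R, IsIdempotentElem e → e = 0 ∨ e = 1 := by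
      intro e he
      by_contra h
      push Not at h
      exact hmax (Subring.exists_isCoatom_of_isIdempotentElem hprime he h.1 h.2)
    have hunit := isUnit_or_eq_zero_of_isUnit_or_isNilpotent hprime fun a =>
      isUnit_or_isNilpotent_of_isIntegral hfield hidem (Algebra.IsIntegral.isIntegral a)
    by_cases hcomm : ∀ a : R, a ∈ Subring.center R
    · let : CommRing R := { mul_comm := fun a b => Subring.mem_center_iff.1 (hcomm b) a }
      let : Field R := Field.ofIsUnitOrEqZero hunit
      refine (not_lt.1 fun h => hmax ?_ : Cardinal.mk R ≤ Cardinal.aleph0).trans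
        Cardinal.aleph0_le_continuum
      exact Subring.exists_isCoatom_of_aleph0_lt h
    · push Not at hcomm
      obtain ⟨a, ha⟩ := hcomm
      let : DivisionRing R := DivisionRing.ofIsUnitOrEqZero hunit
      exact (hmax (Subring.exists_isCoatom_of_not_mem_center ha
        (Algebra.IsIntegral.isIntegral a))).elim
  · push Not at hfield
    obtain ⟨a, ha, ha0, hu⟩ := hfield
    have hts : (Ideal.span {a}).IsTwoSided := ⟨fun {x} y hx => by
      obtain ⟨t, rfl⟩ := Ideal.mem_span_singleton'.1 hx
      rw [mul_assoc, ← Subring.mem_center_iff.1 ha, ← mul_assoc]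
      exact Ideal.mem_span_singleton'.2 ⟨_, rfl⟩⟩
    refine Cardinal.mk_le_continuum_of_adic_separated a (Ideal.span {a}) (fun x hx => ?_)
      (fun x hx => eq_zero_of_forall_pow_dvd hprime ha ha0 hu hx)
      (hquot _ hts (by simpa using ha0))
    obtain ⟨t, rfl⟩ := Ideal.mem_span_singleton'.1 hx
    exact ⟨t, Subring.mem_center_iff.1 ha t⟩

/-- `J` is a finitely generated module over `R/A`, so `|J|` is bounded by a finite power of `|R/A|`;
then `|R| = |R/J| |J|`. -/
theorem Cardinal.mk_le_of_quotient_le {R : Type*} [Ring R] {c : Cardinal}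
    (hc : Cardinal.aleph0 ≤ c) (A J : Ideal R) (hJ : J.FG) (hAJ : ∀ a ∈ A, ∀ x ∈ J, a * x = 0)
    (hA : Cardinal.mk (R ⧸ A) ≤ c) (hRJ : Cardinal.mk (R ⧸ J) ≤ c) : Cardinal.mk R ≤ c := by
  have hJc : Cardinal.mk J ≤ c := by
    obtain ⟨F, hF⟩ := hJ
    have hsurj : ∀ x : J, ∃ y : F → R ⧸ A, (x : R) = ∑ g, (y g).out * (g : R) := by
      intro ⟨x, hx⟩
      rw [← hF, Ideal.span, Submodule.mem_span_finset] at hx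
      obtain ⟨r, -, hr⟩ := hx
      refine ⟨fun g => Submodule.Quotient.mk (r g), ?_⟩
      change x = _
      rw [← hr, ← Finset.sum_coe_sort]
      refine Finset.sum_congr rfl fun g _ => ?_
      have hg : (g : R) ∈ J := hF ▸ Submodule.subset_span g.2
      have h1 : (Submodule.Quotient.mk (r g) : R ⧸ A).out - r g ∈ A :=
        (Submodule.Quotient.eq A).1 (Quotient.out_eq' _)
      have h2 := hAJ _ h1 _ hg
      rw [sub_mul, sub_eq_zero] at h2
      exact h2.symm
    choose f hf using hsurj
    have hinj : Function.Injective f := fun x y hxy => Subtype.ext (by rw [hf x, hf y, hxy])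
    calc Cardinal.mk J ≤ Cardinal.mk (F → R ⧸ A) := Cardinal.mk_le_of_injective hinj
      _ = Cardinal.mk (R ⧸ A) ^ (F.card : Cardinal) := by simp
      _ ≤ c ^ (F.card : Cardinal) := Cardinal.power_le_power_right hA
      _ ≤ c := Cardinal.power_nat_le hc
  calc Cardinal.mk R = Cardinal.mk ((R ⧸ J) × J) := by
        exact Cardinal.mk_congr (AddSubgroup.addGroupEquivQuotientProdAddSubgroup
          (s := J.toAddSubgroup))
    _ = Cardinal.mk (R ⧸ J) * Cardinal.mk J := by simp
    _ ≤ c * c := mul_le_mul' hRJ hJc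
    _ = c := Cardinal.mul_eq_self hc

theorem Cardinal.mk_le_continuum_of_proper_quotients {R : Type*} [Ring R] [IsNoetherianRing R]
    [Algebra.IsIntegral (Subring.center R) R] (hmax : ¬ ∃ M : Subring R, IsCoatom M)
    (hquot : ∀ I : Ideal R, I.IsTwoSided → I ≠ ⊥ → Cardinal.mk (R ⧸ I) ≤ Cardinal.continuum) :
    Cardinal.mk R ≤ Cardinal.continuum := by
  by_cases hprime : ∀ a b : R, (∀ t, a * t * b = 0) → a = 0 ∨ b = 0
  · exact Cardinal.mk_le_continuum_of_prime hprime hmax hquot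
  push Not at hprime
  obtain ⟨a, b, hab, ha, hb⟩ := hprime
  -- `J` is the right annihilator of `aR` and contains `b`; its own left annihilator `A` contains
  -- `a`. Both are thus nonzero two-sided ideals.
  let J : Ideal R :=
    { carrier := {x | ∀ t, a * t * x = 0}
      zero_mem' := fun t => mul_zero _
      add_mem' := fun hx hy t => by rw [mul_add, hx t, hy t, add_zero]
      smul_mem' := fun s x hx t => by rw [smul_eq_mul, ← mul_assoc, mul_assoc a, hx] }
  have hJ : J.IsTwoSided := ⟨fun {x} s (hx : ∀ t, a * t * x = 0) t => by
    rw [← mul_assoc, hx, zero_mul]⟩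
  let A : Ideal R := Module.annihilator R J
  have hA : ∀ r, r ∈ A ↔ ∀ x ∈ J, r * x = 0 := fun r => by
    rw [Module.mem_annihilator]
    exact ⟨fun h x hx => congrArg Subtype.val (h ⟨x, hx⟩), fun h x => Subtype.ext (h x x.2)⟩
  refine Cardinal.mk_le_of_quotient_le Cardinal.aleph0_le_continuum A J
    (IsNoetherian.noetherian J) (fun r hr x hx => (hA r).1 hr x hx)
    (hquot A inferInstance fun h => ?_) (hquot J hJ fun h => ?_)
  · have : a ∈ A := (hA a).2 fun x hx => by simpa using hx 1
    exact ha (by simpa [h] using this)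
  · have : b ∈ J := hab
    exact hb (by simpa [h] using this)

theorem Algebra.IsIntegral.center_of_surjective {R S : Type*} [Ring R] [Ring S] (f : R →+* S)
    (hf : Function.Surjective f) [Algebra.IsIntegral (Subring.center R) R] :
    Algebra.IsIntegral (Subring.center S) S := by
  have hcenter : ∀ z : Subring.center R, f z ∈ Subring.center S := fun z => by
    rw [Subring.mem_center_iff]
    intro s
    obtain ⟨r, rfl⟩ := hf s
    rw [← map_mul, ← map_mul, Subring.mem_center_iff.1 z.2]
  let φ : Subring.center R →+* Subring.center S :=
    (f.comp (Subring.center R).subtype).codRestrict _ hcenter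
  refine ⟨fun s => ?_⟩
  obtain ⟨r, rfl⟩ := hf s
  obtain ⟨p, hp, hpr⟩ := Algebra.IsIntegral.isIntegral (R := Subring.center R) r
  refine ⟨p.map φ, hp.map _, ?_⟩
  rw [Polynomial.eval₂_map]
  have h := congrArg f hpr
  rw [Polynomial.eval₂_eq_sum_range, map_sum, map_zero] at h
  rw [Polynomial.eval₂_eq_sum_range, ← h]
  refine Finset.sum_congr rfl fun i _ => ?_
  rw [map_mul, map_pow]
  rfl

theorem theorem4p9 {T : Type*} [Ring T] [IsNoetherianRing T]
    [Algebra.IsIntegral (Subring.center T) T] :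
    (∃ S : Subring T, IsCoatom S) ∨ Cardinal.mk T ≤ 2 ^ Cardinal.aleph0 := by
  refine or_iff_not_imp_left.2 fun hmax => ?_
  rw [Cardinal.two_power_aleph0]
  have key : ∀ I : Ideal T, I.IsTwoSided → Cardinal.mk (T ⧸ I) ≤ Cardinal.continuum := by
    intro I
    induction I using IsNoetherian.induction with
    | hgt I ih =>
    intro hI
    have hsurj := Ideal.Quotient.mk_surjective (I := I)
    have := isNoetherianRing_of_surjective T (T ⧸ I) (Ideal.Quotient.mk I) hsurj
    have := Algebra.IsIntegral.center_of_surjective (Ideal.Quotient.mk I) hsurj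
    refine Cardinal.mk_le_continuum_of_proper_quotients
      (fun h => hmax (Subring.exists_isCoatom_of_surjective _ hsurj h)) fun K hK hK0 => ?_
    let K' : Ideal T := K.comap (Ideal.Quotient.mk I)
    have hlt : I < K' := by
      obtain ⟨y, hy, hy0⟩ := Submodule.exists_mem_ne_zero_of_ne_bot hK0
      obtain ⟨x, rfl⟩ := hsurj y
      refine ⟨fun z hz => ?_, fun hle => hy0 (Ideal.Quotient.eq_zero_iff_mem.2 (hle hy))⟩
      change Ideal.Quotient.mk I z ∈ K
      rw [Ideal.Quotient.eq_zero_iff_mem.2 hz]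
      exact K.zero_mem
    have hK' : K'.IsTwoSided := inferInstance
    refine (Cardinal.mk_le_of_surjective (f := Ideal.Quotient.lift K'
      ((Ideal.Quotient.mk K).comp (Ideal.Quotient.mk I))
      fun z hz => Ideal.Quotient.eq_zero_iff_mem.2 hz) ?_).trans (ih K' hlt hK')
    exact Ideal.Quotient.lift_surjective_of_surjective _ _
      (Ideal.Quotient.mk_surjective.comp hsurj)
  have hbot := key ⊥ inferInstance
  refine (Cardinal.mk_le_of_injective (f := (Ideal.Quotient.mk (⊥ : Ideal T))) fun x y h => ?_).trans
    hbot
  simpa [sub_eq_zero] using Ideal.Quotient.eq.1 h
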